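/- Consider the Extended CHSH game $\mathrm{CHSH}+1$ with players Alice, Bob and Charlie, who cannot communicate. With probability $1/2$ the verifier asks a consistency question: she sends Alice $A=0$ and Charlie $C=0$, sends Bob nothing, and accepts if the answer bits $X$ of Alice and $Z$ of Charlie satisfy $X=Z$. With probability $1/2$ she asks a game question: she sends independent uniformly random bits $A$ to Alice and $B$ to Bob; if $A=0$ she sends Charlie nothing and accepts if $X=Y$, where $Y$ is Bob's answer bit; if $A=1$ she also sends Charlie $C=1$ and accepts if $(X\oplus Z)\oplus Y=B$. A (multi-round) non-signaling resource of a set of players is a conditional probability distribution of the sequences of outputs of these players given their sequences of inputs, such that for all $j_1,\dots,j_m\ge 0$ the joint distribution of the first $j_i$ outputs of the $i$-th player ($i=1,\dots,m$) depends only on the first $j_i$ inputs of the $i$-th player ($i=1,\dots,m$). For two players with one input each this is an ordinary non-signaling distribution: $\Pr[x\mid a,b]$ does not depend on $b$ and $\Pr[y\mid a,b]$ does not depend on $a$. It is two-local if it is shared by at most two players. (1) Classical players that have shared and local randomness and share any finite number of arbitrary two-local non-signaling resources (with inputs and outputs of arbitrary, discretely distributed types, between any of the pairs of players), which each player may query adaptively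 and in any order, win $\mathrm{CHSH}+1$ with probability at most $7/8$. (2) Let quantum players share the state $\tfrac1{\sqrt2}(|000\rangle+|111\rangle)$, one qubit each, where Alice and Charlie measure $\sigma^z$ on input $0$ and $\sigma^x$ on input $1$, and Bob measures $\tfrac1{\sqrt2}(\sigma^z+(-1)^b\sigma^x)$ on input $b$ (outcome $(-1)^x$ is answered as the bit $x$). They win $\mathrm{CHSH}+1$ with probability $\tfrac78+\tfrac{\sqrt2-1}{8}$, where $\tfrac{\sqrt2-1}{8}>5.17\%$. -/

import Mathlib

open scoped ENNReal ComplexConjugate ComplexOrder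

/-! ## Players, correlations and the game -/

/-- The three players. -/
inductive Player
  | alice
  | bob
  | charlie
  deriving DecidableEq

instance : Fintype Player where
  elems := {.alice, .bob, .charlie}
  complete v := by cases v <;> decide

/-- What the players can do jointly: for every tuple of inputs a probability distribution on tuples
of output bits.  A player receives a bit, or `none` if the verifier sends this player nothing. -/
structure Correlation where
  /-- `prob q r` is the probability of the outputs `r` given the inputs `q`. -/
  prob : (Player → Option Bool) → (Player → Bool) → ℝ
  nonneg : ∀ q r, 0 ≤ prob q r
  sum_one : ∀ q, ∑ r, prob q r = 1

namespace ExtendedCHSH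

/-- Inputs of the consistency question: `A = 0` and `C = 0`; Bob is not asked. -/
def consistencyInput : Player → Option Bool
  | .alice => some false
  | .bob => none
  | .charlie => some false

/-- Inputs of the game question with `A = a`, `B = b`; Charlie is sent `C = 1` if `a = 1` and is not
asked if `a = 0`. -/
def gameInput (a b : Bool) : Player → Option Bool
  | .alice => some a
  | .bob => some b
  | .charlie => if a then some true else none

/-- The verifier accepts the answers to the consistency question if `X = Z`. -/
def ConsistencyAccept (r : Player → Bool) : Prop :=
  r .alice = r .charlie

/-- The verifier accepts the answers to a game question if `X = Y` (when `a = 0`), respectively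
`(X ⊕ Z) ⊕ Y = b` (when `a = 1`). -/
def GameAccept (a b : Bool) (r : Player → Bool) : Prop :=
  if a then xor (xor (r .alice) (r .charlie)) (r .bob) = b else r .alice = r .bob

open Classical in
/-- Probability of acceptance given the consistency question. -/
noncomputable def consistencyWin (P : Correlation) : ℝ :=
  ∑ r with ConsistencyAccept r, P.prob consistencyInput r

open Classical in
/-- Probability of acceptance given the game question with `A = a`, `B = b`. -/
noncomputable def gameWin (P : Correlation) (a b : Bool) : ℝ :=
  ∑ r with GameAccept a b r, P.prob (gameInput a b) r

/-- Winning probability in the game `CHSH + 1`.  A consistency question is chosen with probability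
`1 - 2 / (3 ^ 1 + 1) = 1 / 2`; otherwise a game question is asked, with `A` and `B` independent
uniformly random bits. -/
noncomputable def winProb (P : Correlation) : ℝ :=
  (1 / 2) * consistencyWin P + (1 / 2) * ∑ a : Bool, ∑ b : Bool, (1 / 4) * gameWin P a b

end ExtendedCHSH

/-! ## Non-signaling resources -/

/-- A (multi-round) non-signaling resource shared by the set `s` of players.  Each party can query
the resource again and again, adaptively and asynchronously.  `prob t` is the probability of
the outputs recorded in `t` given the inputs recorded in `t`, where `t v` is the list of the
input/output pairs of party `v` so far, oldest first.  By the condition `marginal`, the joint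
distribution of the outputs obtained so far is not affected by any further input of any party: this
is causality and non-signaling at once.  An ordinary non-signaling distribution is the case in which
the resource returns constants after the first query of each party. -/
structure NSResource (s : Finset Player) where
  /-- Input alphabet of each party. -/
  In : s → Type
  /-- Output alphabet of each party. -/
  Out : s → Type
  prob : ((v : s) → List (In v × Out v)) → ℝ≥0∞
  empty : prob (fun _ => []) = 1
  marginal : ∀ (t : (v : s) → List (In v × Out v)) (v : s) (a : In v),
    ∑' x : Out v, prob (Function.update t v (t v ++ [(a, x)])) = prob t

/-- A finite collection of non-signaling resources, each shared by some set of the players. -/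
structure ResourcePool where
  ι : Type
  [fintype : Fintype ι]
  parties : ι → Finset Player
  res : (i : ι) → NSResource (parties i)

attribute [instance] ResourcePool.fintype

namespace ResourcePool

/-- Everything that has been input to and output by the resources so far. -/
abbrev History (R : ResourcePool) : Type :=
  (i : R.ι) → (v : R.parties i) → List ((R.res i).In v × (R.res i).Out v)

/-- The history before any query. -/
def emptyHistory (R : ResourcePool) : R.History := fun _ _ => []

open Classical in
/-- The history after party `v` inputs `a` to resource `i` and receives `x`. -/
noncomputable def extend (R : ResourcePool) (h : R.History) (i : R.ι) (v : R.parties i)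
    (a : (R.res i).In v) (x : (R.res i).Out v) : R.History :=
  Function.update h i (Function.update (h i) v (h i v ++ [(a, x)]))

/-- Probability of the outputs in a history given its inputs; distinct resources are independent. -/
noncomputable def weight (R : ResourcePool) (h : R.History) : ℝ≥0∞ :=
  ∏ i, (R.res i).prob (h i)

/-- What player `v` does after having received the input (a deterministic adaptive program): either
answer a bit, or query one of the resources that `v` is a party of, and go on depending on the
output. -/
inductive Program (R : ResourcePool) (v : Player) : Type
  | answer (x : Bool) : Program R v
  | query (i : R.ι) (hv : v ∈ R.parties i) (a : (R.res i).In ⟨v, hv⟩)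
      (next : (R.res i).Out ⟨v, hv⟩ → Program R v) : Program R v

/-- Sum of `f x h'` over all possible executions of a program from the history `h` on, where `x` is
the answer and `h'` is the resulting history. -/
noncomputable def Program.sumRuns {R : ResourcePool} {v : Player} (f : Bool → R.History → ℝ≥0∞) :
    Program R v → R.History → ℝ≥0∞
  | .answer x, h => f x h
  | .query i hv a next, h => ∑' o, (next o).sumRuns f (R.extend h i ⟨v, hv⟩ a o)

open Classical in
/-- Probability that the players output `r` when player `v` runs the program `π v`: the sum over all
triples of executions that lead to the outputs `r` of the probability of the resources' outputs given
their inputs.  (The order of the three sums is irrelevant.) -/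
noncomputable def outcome (R : ResourcePool) (π : (v : Player) → R.Program v) (r : Player → Bool) :
    ℝ≥0∞ :=
  (π .alice).sumRuns (fun x =>
    (π .bob).sumRuns (fun y =>
      (π .charlie).sumRuns (fun z h =>
        if r .alice = x ∧ r .bob = y ∧ r .charlie = z then R.weight h else 0))) R.emptyHistory

/-- A non-signaling resource's marginal condition, for the weight of a history. -/
theorem tsum_weight_extend (R : ResourcePool) (h : R.History) (i : R.ι) (v : R.parties i)
    (a : (R.res i).In v) : ∑' x, R.weight (R.extend h i v a x) = R.weight h := by
  classical
  unfold weight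
  have key : ∀ x, ∏ j, (R.res j).prob (R.extend h i v a x j)
      = (R.res i).prob (Function.update (h i) v (h i v ++ [(a, x)]))
        * ∏ j ∈ Finset.univ.erase i, (R.res j).prob (h j) := by
    intro x
    rw [← Finset.mul_prod_erase Finset.univ _ (Finset.mem_univ i)]
    congr 1
    · unfold extend
      rw [Function.update_self]
    · refine Finset.prod_congr rfl fun j hj => ?_
      unfold extend
      rw [Function.update_of_ne (Finset.ne_of_mem_erase hj)]
  simp_rw [key]
  rw [ENNReal.tsum_mul_right, (R.res i).marginal,
    Finset.mul_prod_erase Finset.univ (fun j => (R.res j).prob (h j)) (Finset.mem_univ i)]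

theorem Program.sumRuns_weight {R : ResourcePool} {v : Player} (p : R.Program v) (h : R.History) :
    p.sumRuns (fun _ => R.weight) h = R.weight h := by
  induction p generalizing h with
  | answer x => rfl
  | query i hv a next ih =>
    simp only [Program.sumRuns, ih]
    exact R.tsum_weight_extend h i ⟨v, hv⟩ a

theorem Program.sumRuns_sum {R : ResourcePool} {v : Player} {α : Type} (s : Finset α)
    (f : α → Bool → R.History → ℝ≥0∞) (p : R.Program v) (h : R.History) :
    p.sumRuns (fun x h => ∑ k ∈ s, f k x h) h = ∑ k ∈ s, p.sumRuns (f k) h := by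
  induction p generalizing h with
  | answer x => rfl
  | query i hv a next ih =>
    simp only [Program.sumRuns, ih]
    exact Summable.tsum_finsetSum fun _ _ => ENNReal.summable

/-- The outcome probabilities add up to one. -/
theorem sum_outcome (R : ResourcePool) (π : (v : Player) → R.Program v) :
    ∑ r, R.outcome π r = 1 := by
  classical
  have hind : ∀ (x y z : Bool) (h : R.History),
      ∑ r : Player → Bool,
        (if r .alice = x ∧ r .bob = y ∧ r .charlie = z then R.weight h else 0) = R.weight h := by
    intro x y z h
    let r₀ : Player → Bool := fun v => match v with
      | .alice => x
      | .bob => y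
      | .charlie => z
    rw [Finset.sum_eq_single r₀]
    · simp [r₀]
    · intro r _ hr
      rw [if_neg]
      rintro ⟨h1, h2, h3⟩
      exact hr (funext fun v => by cases v <;> assumption)
    · simp
  unfold outcome
  rw [← Program.sumRuns_sum]
  simp_rw [← Program.sumRuns_sum, hind, Program.sumRuns_weight]
  unfold weight emptyHistory
  exact Finset.prod_eq_one fun i _ => (R.res i).empty

end ResourcePool

/-! ## Classical strategies -/

/-- A strategy of classical players that share a pool of non-signaling resources, and randomness
drawn from a probability space `Λ` (which also provides all local randomness).  The players do not
communicate: what a player does depends only on the shared randomness, the own input and the own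
interaction with the resources. -/
structure ClassicalStrategy extends ResourcePool where
  Λ : Type
  [measurableSpace : MeasurableSpace Λ]
  μ : MeasureTheory.Measure Λ
  [isProbabilityMeasure : MeasureTheory.IsProbabilityMeasure μ]
  prog : Λ → (v : Player) → Option Bool → toResourcePool.Program v
  measurable : ∀ (q : Player → Option Bool) (r : Player → Bool),
    Measurable fun l => toResourcePool.outcome (fun v => prog l v (q v)) r

attribute [instance] ClassicalStrategy.measurableSpace ClassicalStrategy.isProbabilityMeasure

namespace ClassicalStrategy

/-- Each resource is shared by at most two players. -/
def TwoLocal (S : ClassicalStrategy) : Prop := ∀ i, (S.parties i).card ≤ 2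

/-- Probability of the outputs `r` given the inputs `q`. -/
noncomputable def prob (S : ClassicalStrategy) (q : Player → Option Bool) (r : Player → Bool) :
    ℝ≥0∞ :=
  ∫⁻ l, S.outcome (fun v => S.prog l v (q v)) r ∂S.μ

theorem sum_prob (S : ClassicalStrategy) (q : Player → Option Bool) : ∑ r, S.prob q r = 1 := by
  unfold prob
  rw [← MeasureTheory.lintegral_finsetSum _ (fun r _ => S.measurable q r)]
  simp [ResourcePool.sum_outcome]

/-- The correlation that a strategy produces. -/
noncomputable def correlation (S : ClassicalStrategy) : Correlation where
  prob q r := (S.prob q r).toReal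
  nonneg _ _ := ENNReal.toReal_nonneg
  sum_one q := by
    have h := S.sum_prob q
    rw [← ENNReal.toReal_sum, h, ENNReal.toReal_one]
    intro r _ hr
    have : S.prob q r ≤ 1 := h ▸ Finset.single_le_sum (f := fun r => S.prob q r)
      (fun _ _ => zero_le) (Finset.mem_univ r)
    rw [hr] at this
    exact absurd this (by simp)

end ClassicalStrategy

/-! ## Quantum strategies on three qubits -/

/-- A strategy of quantum players that share a pure state of three qubits, one for each player, and
measure their qubits. -/
structure QuantumStrategy where
  /-- Amplitudes of the shared state in the computational basis. -/
  state : (Player → Fin 2) → ℂ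
  normalized : ∑ k, ‖state k‖ ^ 2 = 1
  /-- `meas v q x` is the measurement operator of player `v` for the input `q` and the output `x`. -/
  meas : Player → Option Bool → Bool → Matrix (Fin 2) (Fin 2) ℂ
  posSemidef : ∀ v q x, (meas v q x).PosSemidef
  complete : ∀ v q, ∑ x, meas v q x = 1

namespace QuantumStrategy

/-- `⟨ψ| ⨂ᵥ Mᵥ |ψ⟩`, for the state `ψ` and the measurement operators `Mᵥ` for inputs `q` and
outputs `r`. -/
noncomputable def amplitude (S : QuantumStrategy) (q : Player → Option Bool) (r : Player → Bool) :
    ℂ :=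
  ∑ k, ∑ l, conj (S.state k) * (∏ v, S.meas v (q v) (r v) (k v) (l v)) * S.state l

open scoped MatrixOrder Matrix.Norms.L2Operator in
theorem re_amplitude_nonneg (S : QuantumStrategy) (q : Player → Option Bool) (r : Player → Bool) :
    0 ≤ (S.amplitude q r).re := by
  have hB : ∀ v, ∃ B : Matrix (Fin 2) (Fin 2) ℂ, S.meas v (q v) (r v) = B.conjTranspose * B :=
    fun v => CStarAlgebra.nonneg_iff_eq_star_mul_self.mp (S.posSemidef v (q v) (r v)).nonneg
  choose B hB using hB
  have key : S.amplitude q r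
      = ∑ m : Player → Fin 2, conj (∑ k, (∏ v, B v (m v) (k v)) * S.state k)
          * ∑ l, (∏ v, B v (m v) (l v)) * S.state l := by
    have hprod : ∀ k l : Player → Fin 2, ∏ v, S.meas v (q v) (r v) (k v) (l v)
        = ∑ m : Player → Fin 2, (∏ v, conj (B v (m v) (k v))) * ∏ v, B v (m v) (l v) := by
      intro k l
      simp_rw [hB, Matrix.mul_apply, Matrix.conjTranspose_apply, Finset.prod_univ_sum,
        ← Finset.prod_mul_distrib]
      simp
    unfold amplitude
    simp_rw [hprod, map_sum, map_mul, map_prod, Finset.sum_mul_sum, Finset.mul_sum, Finset.sum_mul]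
    calc _ = ∑ k, ∑ m : Player → Fin 2, ∑ l, conj (S.state k) *
          ((∏ v, conj (B v (m v) (k v))) * ∏ v, B v (m v) (l v)) * S.state l :=
            Finset.sum_congr rfl fun k _ => Finset.sum_comm
      _ = ∑ m : Player → Fin 2, ∑ k, ∑ l, conj (S.state k) *
          ((∏ v, conj (B v (m v) (k v))) * ∏ v, B v (m v) (l v)) * S.state l := Finset.sum_comm
      _ = _ := by
        refine Finset.sum_congr rfl fun m _ => Finset.sum_congr rfl fun k _ =>
          Finset.sum_congr rfl fun l _ => ?_
        ring
  rw [key, Complex.re_sum]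
  refine Finset.sum_nonneg fun m _ => ?_
  rw [← Complex.normSq_eq_conj_mul_self, Complex.ofReal_re]
  exact Complex.normSq_nonneg _

theorem sum_amplitude (S : QuantumStrategy) (q : Player → Option Bool) :
    ∑ r, S.amplitude q r = 1 := by
  classical
  have hprod : ∀ k l : Player → Fin 2,
      ∑ r : Player → Bool, ∏ v, S.meas v (q v) (r v) (k v) (l v) = if k = l then 1 else 0 := by
    intro k l
    have h1 : ∑ r : Player → Bool, ∏ v, S.meas v (q v) (r v) (k v) (l v)
        = ∏ v, ∑ x, S.meas v (q v) x (k v) (l v) := by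
      rw [Finset.prod_univ_sum, Fintype.piFinset_univ]
    have h2 : ∀ v, ∑ x, S.meas v (q v) x (k v) (l v) = if k v = l v then 1 else 0 := by
      intro v
      rw [← Matrix.sum_apply, S.complete, Matrix.one_apply]
    rw [h1]
    simp_rw [h2]
    rw [Finset.prod_ite_zero]
    simp [funext_iff]
  unfold amplitude
  rw [Finset.sum_comm]
  simp_rw [Finset.sum_comm (s := (Finset.univ : Finset (Player → Bool))), ← Finset.sum_mul,
    ← Finset.mul_sum, hprod]
  simp only [mul_ite, mul_one, mul_zero, ite_mul, zero_mul, Finset.sum_ite_eq, Finset.mem_univ,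
    if_true, Complex.conj_mul']
  exact_mod_cast S.normalized

/-- The correlation that a strategy produces. -/
noncomputable def correlation (S : QuantumStrategy) : Correlation where
  prob q r := (S.amplitude q r).re
  nonneg := S.re_amplitude_nonneg
  sum_one q := by rw [← Complex.re_sum, S.sum_amplitude q, Complex.one_re]

end QuantumStrategy

/-! ## The GHZ strategy -/

namespace GHZ

/-- The Pauli matrix `σᶻ`. -/
def sigmaZ : Matrix (Fin 2) (Fin 2) ℂ := !![1, 0; 0, -1]

/-- The Pauli matrix `σˣ`. -/
def sigmaX : Matrix (Fin 2) (Fin 2) ℂ := !![0, 1; 1, 0]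

/-- The sign `(-1) ^ x` of a bit `x`. -/
def sign (x : Bool) : ℂ := if x then -1 else 1

/-- The observable that a player measures on a given input bit. -/
noncomputable def observable : Player → Bool → Matrix (Fin 2) (Fin 2) ℂ
  | .bob, b => ((Real.sqrt 2 : ℂ)⁻¹) • (sigmaZ + sign b • sigmaX)
  | .alice, false => sigmaZ
  | .alice, true => sigmaX
  | .charlie, false => sigmaZ
  | .charlie, true => sigmaX

/-- The measurement operator for output `x` when measuring an observable `O` with `O ^ 2 = 1`: the
projection onto the `(-1) ^ x`-eigenspace of `O`. -/
noncomputable def effect (O : Matrix (Fin 2) (Fin 2) ℂ) (x : Bool) : Matrix (Fin 2) (Fin 2) ℂ :=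
  (1 / 2 : ℂ) • (1 + sign x • O)

/-- The GHZ state `(|000⟩ + |111⟩) / √2`. -/
noncomputable def state (k : Player → Fin 2) : ℂ :=
  if k = (fun _ => 0) ∨ k = (fun _ => 1) then (Real.sqrt 2 : ℂ)⁻¹ else 0

theorem sqrt_two_inv_sq : ((Real.sqrt 2 : ℂ)⁻¹) * ((Real.sqrt 2 : ℂ)⁻¹) = 1 / 2 := by
  rw [← mul_inv, ← Complex.ofReal_mul, Real.mul_self_sqrt (by norm_num)]
  norm_num

theorem observable_isHermitian (v : Player) (b : Bool) : (observable v b).IsHermitian := by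
  cases v <;> cases b <;> ext i j <;> fin_cases i <;> fin_cases j <;>
    simp [observable, sigmaX, sigmaZ, sign]

theorem observable_mul_self (v : Player) (b : Bool) : observable v b * observable v b = 1 := by
  have h := sqrt_two_inv_sq
  cases v <;> cases b <;> ext i j <;> fin_cases i <;> fin_cases j <;>
    simp [observable, sigmaX, sigmaZ, sign, Matrix.mul_apply, Fin.sum_univ_two] <;>
    linear_combination 2 * h

theorem effect_posSemidef {O : Matrix (Fin 2) (Fin 2) ℂ} (h1 : O.IsHermitian) (h2 : O * O = 1)
    (x : Bool) : (effect O x).PosSemidef := by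
  have hH : (effect O x).conjTranspose = effect O x := by
    cases x <;> simp [effect, sign, h1.eq]
  have hP : effect O x = (effect O x).conjTranspose * effect O x := by
    rw [hH]
    unfold effect
    simp only [Matrix.smul_mul, Matrix.mul_smul, Matrix.add_mul, Matrix.mul_add, Matrix.one_mul,
      Matrix.mul_one, h2]
    cases x <;> simp only [sign] <;> simp <;> module
  rw [hP]
  exact Matrix.posSemidef_conjTranspose_mul_self _

theorem sum_effect (O : Matrix (Fin 2) (Fin 2) ℂ) : ∑ x, effect O x = 1 := by
  simp only [Fintype.sum_bool, effect, sign]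
  simp
  module

theorem state_normalized : ∑ k, ‖state k‖ ^ 2 = 1 := by
  classical
  have hne : (fun _ => 0 : Player → Fin 2) ≠ fun _ => 1 := fun h => by
    simpa using congrFun h .alice
  have : ∀ k : Player → Fin 2, ‖state k‖ ^ 2
      = (if k = (fun _ => 0) then (1 / 2 : ℝ) else 0) + if k = (fun _ => 1) then 1 / 2 else 0 := by
    intro k
    unfold state
    by_cases h0 : k = fun _ => 0
    · simp [h0, hne]
    · by_cases h1 : k = fun _ => 1
      · simp [h1, hne.symm]
      · simp [h0, h1]
  simp_rw [this, Finset.sum_add_distrib]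
  simp
  norm_num

/-- The quantum strategy for the GHZ state: Alice and Charlie measure `σᶻ` on input `0` and `σˣ` on
input `1`; Bob measures `(σᶻ + (-1) ^ b σˣ) / √2` on input `b`.  (A player who is not asked measures as on
input `0`; the verifier ignores this output.) -/
noncomputable def strategy : QuantumStrategy where
  state := state
  normalized := state_normalized
  meas v q x := effect (observable v (q.getD false)) x
  posSemidef v q x := effect_posSemidef (observable_isHermitian v (q.getD false))
    (observable_mul_self v (q.getD false)) x
  complete _ _ := sum_effect _

end GHZ

/-! Classical bound. Replace every resource shared by Bob and Charlie by the product of its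
marginals. Since resources are two-local, the product is again non-signaling, and the joint law of
Alice with either of the others is unchanged, because a player whose answer is ignored can be summed
out. After the cut `Y` and `Z` are independent, yet `Y ≠ Z` still forces `X ≠ Y` or `X ≠ Z`. Hence,
with `p = Pr[Z = 1 | C = 0]` and `q_b = Pr[Y = 1 | B = b]`, the quantity `q_b (1 - p) + (1 - q_b) p`
is at most the sum of the error probabilities of the consistency question and of the game question
`A = 0`, `B = b` (`expect_mul_expect_not_le`). So if the players rarely err for `A = 0`, Bob's
answer is nearly the same constant for both `b`. For `A = 1` it must, however, equal `X ⊕ Z ⊕ b`,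
where the law of `X ⊕ Z` does not depend on `b` (`expect_xor_le`). A linear trade-off between these
facts gives 7/8 (`four_mul_add_le_seven`).

Quantum value. For the GHZ state the consistency question is always won and every game question is
won with probability `(1 + 1/√2) / 2`; this is a finite computation with 2 × 2 matrices. -/

namespace ResourcePool

/-! ### No-signaling for adaptive programs -/

variable {R : ResourcePool}

/-- A function of the history that averages out over the response to any query of player `v`. -/
def NoSignalFrom (v : Player) (g : R.History → ℝ≥0∞) : Prop :=
  ∀ (h : R.History) (i : R.ι) (hv : v ∈ R.parties i) (a : (R.res i).In ⟨v, hv⟩),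
    ∑' x, g (R.extend h i ⟨v, hv⟩ a x) = g h

/-- A function of the history that no query of player `v` changes. -/
def InvariantUnder (v : Player) (g : R.History → ℝ≥0∞) : Prop :=
  ∀ (h : R.History) (i : R.ι) (hv : v ∈ R.parties i) (a : (R.res i).In ⟨v, hv⟩) x,
    g (R.extend h i ⟨v, hv⟩ a x) = g h

/-- The two queries write to different entries of the history, even if they address the same
resource. This is what makes the order in which the players run irrelevant. -/
theorem extend_comm (h : R.History) {i j : R.ι} {u : R.parties i} {v : R.parties j}
    (huv : u.1 ≠ v.1) (a : (R.res i).In u) (x : (R.res i).Out u) (b : (R.res j).In v)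
    (y : (R.res j).Out v) :
    R.extend (R.extend h i u a x) j v b y = R.extend (R.extend h j v b y) i u a x := by
  classical
  by_cases hij : i = j
  · subst hij
    have huv' : u ≠ v := fun h => huv (congrArg _ h)
    unfold extend
    simp only [Function.update_self, Function.update_idem, Function.update_of_ne huv',
      Function.update_of_ne huv'.symm]
    rw [Function.update_comm huv']
  · unfold extend
    simp only [Function.update_of_ne hij, Function.update_of_ne (Ne.symm hij)]
    rw [Function.update_comm hij]

namespace Program

variable {u v : Player}

theorem sumRuns_noSignal {g : R.History → ℝ≥0∞} (hg : NoSignalFrom v g) (p : R.Program v)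
    (h : R.History) : p.sumRuns (fun _ => g) h = g h := by
  induction p generalizing h with
  | answer x => rfl
  | query i hv a next ih =>
    simp only [sumRuns, ih]
    exact hg h i hv a

/-- Interchange the sums over the responses to `u` and to `v`. It allows a player to be summed out
although another player's run comes later in the nesting. -/
theorem noSignalFrom_sumRuns (huv : u ≠ v) {f : Bool → R.History → ℝ≥0∞}
    (hf : ∀ x, NoSignalFrom u (f x)) (p : R.Program v) : NoSignalFrom u (p.sumRuns f) := by
  induction p with
  | answer x => exact hf x
  | query j hv b next ih =>
    intro h i hu a
    simp only [sumRuns]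
    rw [ENNReal.tsum_comm]
    refine tsum_congr fun y => ?_
    rw [← ih y _ i hu a]
    refine tsum_congr fun x => ?_
    rw [extend_comm h (u := ⟨u, hu⟩) (v := ⟨v, hv⟩) huv]

theorem sumRuns_mul {g : R.History → ℝ≥0∞} (hg : InvariantUnder v g)
    (f : Bool → R.History → ℝ≥0∞) (p : R.Program v) (h : R.History) :
    p.sumRuns (fun x h => g h * f x h) h = g h * p.sumRuns f h := by
  induction p generalizing h with
  | answer x => rfl
  | query i hv a next ih =>
    simp only [sumRuns, ih, ENNReal.tsum_mul_left, hg h i hv a]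

theorem sumRuns_mono {f g : Bool → R.History → ℝ≥0∞} (hfg : ∀ x h, f x h ≤ g x h)
    (p : R.Program v) (h : R.History) : p.sumRuns f h ≤ p.sumRuns g h := by
  induction p generalizing h with
  | answer x => exact hfg x h
  | query i hv a next ih => exact ENNReal.tsum_le_tsum fun o => ih o _

theorem sumRuns_add (f g : Bool → R.History → ℝ≥0∞) (p : R.Program v) (h : R.History) :
    p.sumRuns (fun x h => f x h + g x h) h = p.sumRuns f h + p.sumRuns g h := by
  induction p generalizing h with
  | answer x => rfl
  | query i hv a next ih => simp only [sumRuns, ih, ENNReal.tsum_add]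

/-- `P` is an invariant of the run; in the applications it says that some other player has not made
any query. -/
theorem sumRuns_congr {P : R.History → Prop}
    (hP : ∀ h, P h → ∀ i (hv : v ∈ R.parties i) a x, P (R.extend h i ⟨v, hv⟩ a x))
    {f g : Bool → R.History → ℝ≥0∞} (hfg : ∀ x h, P h → f x h = g x h)
    (p : R.Program v) {h : R.History} (hh : P h) : p.sumRuns f h = p.sumRuns g h := by
  induction p generalizing h with
  | answer x => exact hfg x h hh
  | query i hv a next ih => exact tsum_congr fun o => ih o (hP h hh i hv a o)

end Program

/-! ### Forgetting the queries of a player -/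

/-- The history of a single resource with the queries of player `u` deleted. -/
def erase {s : Finset Player} {α : s → Type} (u : Player) (t : (v : s) → List (α v)) :
    (v : s) → List (α v) :=
  fun v => if v.1 = u then [] else t v

theorem erase_update_self {s : Finset Player} {α : s → Type} {u : s}
    (t : (v : s) → List (α v)) (l : List (α u)) :
    erase u.1 (Function.update t u l) = erase u.1 t := by
  funext w
  by_cases hw : w.1 = u.1
  · simp [erase, hw]
  · have : w ≠ u := fun h => hw (congrArg _ h)
    simp [erase, hw, Function.update_of_ne this]

theorem erase_update_of_ne {s : Finset Player} {α : s → Type} {u : Player} {v : s}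
    (huv : v.1 ≠ u) (t : (v : s) → List (α v)) (l : List (α v)) :
    erase u (Function.update t v l) = Function.update (erase u t) v l := by
  funext w
  by_cases hw : w = v
  · subst hw
    simp [erase, huv]
  · simp [erase, Function.update_of_ne hw]

theorem erase_apply_of_ne {s : Finset Player} {α : s → Type} {u : Player} {v : s}
    (huv : v.1 ≠ u) (t : (v : s) → List (α v)) : erase u t v = t v := if_neg huv

/-- The history with the queries of player `u` deleted. -/
def forget (u : Player) (h : R.History) : R.History := fun i => erase u (h i)

theorem forget_extend_self (h : R.History) (i : R.ι) (v : R.parties i)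
    (a : (R.res i).In v) (x : (R.res i).Out v) :
    forget v.1 (R.extend h i v a x) = forget v.1 h := by
  classical
  funext j
  by_cases hj : j = i
  · subst hj
    simp only [forget, extend, Function.update_self]
    exact erase_update_self _ _
  · simp only [forget, extend, Function.update_of_ne hj]

theorem forget_extend_of_ne {u : Player} (h : R.History) (i : R.ι) (v : R.parties i)
    (huv : v.1 ≠ u) (a : (R.res i).In v) (x : (R.res i).Out v) :
    forget u (R.extend h i v a x) = R.extend (forget u h) i v a x := by
  classical
  funext j
  by_cases hj : j = i
  · subst hj
    simp only [forget, extend, Function.update_self]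
    rw [erase_apply_of_ne huv]
    exact erase_update_of_ne huv _ _
  · simp only [forget, extend, Function.update_of_ne hj]

theorem forget_emptyHistory (u : Player) : forget u R.emptyHistory = R.emptyHistory := by
  funext i v
  simp [forget, erase, emptyHistory]

theorem forget_extend_eq {u v : Player} (huv : v ≠ u) (h : R.History) (hh : forget u h = h)
    (i : R.ι) (hv : v ∈ R.parties i) (a : (R.res i).In ⟨v, hv⟩) (x : (R.res i).Out ⟨v, hv⟩) :
    forget u (R.extend h i ⟨v, hv⟩ a x) = R.extend h i ⟨v, hv⟩ a x := by
  rw [forget_extend_of_ne h i ⟨v, hv⟩ huv, hh]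

/-- Deleting the queries of `u` commutes with those of `v`, so it can be done before the run instead
of after it. -/
theorem Program.sumRuns_forget {u v : Player} (huv : v ≠ u) (f : Bool → R.History → ℝ≥0∞)
    (p : R.Program v) (h : R.History) :
    p.sumRuns (fun x h => f x (forget u h)) h = p.sumRuns f (forget u h) := by
  induction p generalizing h with
  | answer x => rfl
  | query i hv a next ih =>
    simp only [sumRuns, ih]
    exact tsum_congr fun x => by rw [forget_extend_of_ne h i ⟨v, hv⟩ huv]

/-! ### Cutting the resources shared by two players -/

/-- The distribution of a resource of `u` and `v` replaced by the product of its marginals. -/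
noncomputable def cutProb (u v : Player) {s : Finset Player} (ρ : NSResource s)
    (t : (v : s) → List (ρ.In v × ρ.Out v)) : ℝ≥0∞ :=
  if u ∈ s ∧ v ∈ s then ρ.prob (erase v t) * ρ.prob (erase u t) else ρ.prob t

theorem eq_or_eq_of_card_le_two {u v w : Player} {s : Finset Player} (hs : s.card ≤ 2)
    (huv : u ≠ v) (hu : u ∈ s) (hv : v ∈ s) (hw : w ∈ s) : w = u ∨ w = v := by
  by_contra! hne
  have hsub : ({u, v, w} : Finset Player) ⊆ s := by
    intro x hx
    simp only [Finset.mem_insert, Finset.mem_singleton] at hx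
    rcases hx with rfl | rfl | rfl <;> assumption
  have := Finset.card_le_card hsub
  rw [Finset.card_eq_three.mpr ⟨u, v, w, huv, hne.1.symm, hne.2.symm, rfl⟩] at this
  omega

/-- By two-locality, a resource of both `u` and `v` has no third party, so a query changes exactly
one of the two factors, and that factor is summed by the marginal condition of `ρ`. -/
theorem tsum_cutProb {u v : Player} (huv : u ≠ v) {s : Finset Player} (hs : s.card ≤ 2)
    (ρ : NSResource s) (t : (v : s) → List (ρ.In v × ρ.Out v)) (w : s) (a : ρ.In w) :
    ∑' x, cutProb u v ρ (Function.update t w (t w ++ [(a, x)])) = cutProb u v ρ t := by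
  unfold cutProb
  split_ifs with hmem
  · obtain ⟨w, hw⟩ := w
    rcases eq_or_eq_of_card_le_two hs huv hmem.1 hmem.2 hw with rfl | rfl
    · have h1 := fun l => erase_update_self (u := (⟨w, hw⟩ : s)) t l
      have h2 := fun l => erase_update_of_ne (u := v) (v := (⟨w, hw⟩ : s)) huv t l
      simp only [h1, h2, ENNReal.tsum_mul_right]
      rw [← ρ.marginal (erase v t) ⟨w, hw⟩ a, erase_apply_of_ne (v := (⟨w, hw⟩ : s)) huv]
    · have h1 := fun l => erase_update_self (u := (⟨w, hw⟩ : s)) t l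
      have h2 := fun l => erase_update_of_ne (u := u) (v := (⟨w, hw⟩ : s)) huv.symm t l
      simp only [h1, h2, ENNReal.tsum_mul_left]
      rw [← ρ.marginal (erase u t) ⟨w, hw⟩ a, erase_apply_of_ne (v := (⟨w, hw⟩ : s)) huv.symm]
  · exact ρ.marginal t w a

/-- The weight of a history if the resources shared by `u` and `v` are replaced by independent
copies for these two players. -/
noncomputable def cutWeight (u v : Player) (h : R.History) : ℝ≥0∞ :=
  ∏ i, cutProb u v (R.res i) (h i)

theorem cutWeight_comm (u v : Player) (h : R.History) : cutWeight u v h = cutWeight v u h := by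
  unfold cutWeight cutProb
  simp only [and_comm, mul_comm]

theorem noSignalFrom_weight (w : Player) : NoSignalFrom w R.weight :=
  fun h i hw a => R.tsum_weight_extend h i ⟨w, hw⟩ a

theorem noSignalFrom_cutWeight (hR : ∀ i, (R.parties i).card ≤ 2) {u v : Player} (huv : u ≠ v)
    (w : Player) : NoSignalFrom w (cutWeight (R := R) u v) := by
  classical
  intro h i hw a
  unfold cutWeight
  have key : ∀ x, ∏ j, cutProb u v (R.res j) (R.extend h i ⟨w, hw⟩ a x j)
      = cutProb u v (R.res i) (Function.update (h i) ⟨w, hw⟩ (h i ⟨w, hw⟩ ++ [(a, x)]))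
        * ∏ j ∈ Finset.univ.erase i, cutProb u v (R.res j) (h j) := by
    intro x
    rw [← Finset.mul_prod_erase Finset.univ _ (Finset.mem_univ i)]
    congr 1
    · unfold extend
      rw [Function.update_self]
    · refine Finset.prod_congr rfl fun j hj => ?_
      unfold extend
      rw [Function.update_of_ne (Finset.ne_of_mem_erase hj)]
  simp_rw [key]
  rw [ENNReal.tsum_mul_right, tsum_cutProb huv (hR i),
    Finset.mul_prod_erase Finset.univ (fun j => cutProb u v (R.res j) (h j)) (Finset.mem_univ i)]

/-- If `v` has not made any query, the cut has no effect. -/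
theorem cutWeight_eq_weight (hR : ∀ i, (R.parties i).card ≤ 2) {u v : Player} (huv : u ≠ v)
    {h : R.History} (hh : forget v h = h) : cutWeight u v h = R.weight h := by
  refine Finset.prod_congr rfl fun i _ => ?_
  unfold cutProb
  split_ifs with hmem
  · have h1 : erase v (h i) = h i := congrFun hh i
    -- The only other party is `v`, which has no queries, so this factor is the probability 1 of the
    -- empty history.
    have h2 : erase u (h i) = fun _ => [] := by
      funext w
      rcases eq_or_eq_of_card_le_two (hR i) huv hmem.1 hmem.2 w.2 with hw | hw
      · simp [erase, hw]
      · rw [← h1]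
        simp [erase, hw]
    rw [h1, h2, (R.res i).empty, mul_one]
  · rfl

/-- If only `u` and `v` have made queries, they are independent after the cut. -/
theorem cutWeight_eq_mul {u v w : Player} (hw : ∀ x, x = u ∨ x = v ∨ x = w)
    {h : R.History} (hh : forget w h = h) :
    cutWeight u v h = R.weight (forget v h) * R.weight (forget u h) := by
  unfold weight
  rw [← Finset.prod_mul_distrib]
  refine Finset.prod_congr rfl fun i _ => ?_
  -- A resource without party `b` has been queried by `a` at most, so one of the two factors is its
  -- full probability and the other one is 1.
  have key : ∀ a b : Player, (∀ x, x = a ∨ x = b ∨ x = w) → b ∉ R.parties i →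
      erase b (h i) = h i ∧ erase a (h i) = fun _ => [] := by
    intro a b hab hb
    constructor <;> funext x
    · have : x.1 ≠ b := fun hx => hb (hx ▸ x.2)
      simp [erase, this]
    · have hi : erase w (h i) = h i := congrFun hh i
      rcases hab x.1 with hx | hx | hx
      · simp [erase, hx]
      · exact absurd (hx ▸ x.2) hb
      · rw [← hi]
        simp [erase, hx]
  unfold cutProb
  split_ifs with hmem
  · rfl
  · simp only [forget]
    by_cases hv : v ∈ R.parties i
    · have hu : u ∉ R.parties i := fun hu => hmem ⟨hu, hv⟩
      obtain ⟨h1, h2⟩ := key v u (fun x => by have := hw x; tauto) hu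
      rw [h1, h2, (R.res i).empty, one_mul]
    · obtain ⟨h1, h2⟩ := key u v hw hv
      rw [h1, h2, (R.res i).empty, mul_one]

/-! ### Expectations of functions of the answers -/

/-- Expectation of a function of the three answers, when histories are weighted by `w`. -/
noncomputable def expect (w : R.History → ℝ≥0∞) (p : R.Program .alice) (q : R.Program .bob)
    (s : R.Program .charlie) (f : Bool → Bool → Bool → ℝ≥0∞) : ℝ≥0∞ :=
  p.sumRuns (fun x => q.sumRuns fun y => s.sumRuns fun z h => f x y z * w h) R.emptyHistory

variable {w : R.History → ℝ≥0∞} (p : R.Program .alice) (q : R.Program .bob)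
  (s : R.Program .charlie)

theorem NoSignalFrom.const_mul {v : Player} {g : R.History → ℝ≥0∞} (hg : NoSignalFrom v g)
    (c : ℝ≥0∞) : NoSignalFrom v fun h => c * g h := fun h i hv a => by
  rw [ENNReal.tsum_mul_left, hg h i hv a]

theorem expect_mono {f g : Bool → Bool → Bool → ℝ≥0∞} (hfg : ∀ x y z, f x y z ≤ g x y z) :
    expect w p q s f ≤ expect w p q s g :=
  Program.sumRuns_mono (fun x h => Program.sumRuns_mono (fun y h => Program.sumRuns_mono
    (fun z h => by gcongr; exact hfg x y z) _ h) _ h) _ _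

theorem expect_add (f g : Bool → Bool → Bool → ℝ≥0∞) :
    expect w p q s (fun x y z => f x y z + g x y z) = expect w p q s f + expect w p q s g := by
  unfold expect
  simp_rw [← Program.sumRuns_add, add_mul]

/-- Charlie runs last and his answer is ignored, so no-signaling removes his run. The right side
does not mention `s`: his input is irrelevant. -/
theorem expect_alice_bob (hw : ∀ v, NoSignalFrom v w) (f : Bool → Bool → ℝ≥0∞) :
    expect w p q s (fun x y _ => f x y)
      = p.sumRuns (fun x => q.sumRuns fun y h => f x y * w h) R.emptyHistory := by
  unfold expect
  congr! 4 with x y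
  exact funext fun h => Program.sumRuns_noSignal ((hw _).const_mul _) s h

theorem expect_alice_charlie (hw : ∀ v, NoSignalFrom v w) (f : Bool → Bool → ℝ≥0∞) :
    expect w p q s (fun x _ z => f x z)
      = p.sumRuns (fun x => s.sumRuns fun z h => f x z * w h) R.emptyHistory := by
  unfold expect
  congr! 2 with x
  exact funext fun h => Program.sumRuns_noSignal
    (Program.noSignalFrom_sumRuns (by decide) (fun z => (hw _).const_mul _) s) q h

theorem expect_bob_charlie (hw : ∀ v, NoSignalFrom v w) (f : Bool → Bool → ℝ≥0∞) :
    expect w p q s (fun _ y z => f y z)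
      = q.sumRuns (fun y => s.sumRuns fun z h => f y z * w h) R.emptyHistory :=
  Program.sumRuns_noSignal (Program.noSignalFrom_sumRuns (by decide) (fun y =>
    Program.noSignalFrom_sumRuns (by decide) (fun z => (hw _).const_mul _) s) q) p _

theorem expect_bob (hw : ∀ v, NoSignalFrom v w) (f : Bool → ℝ≥0∞) :
    expect w p q s (fun _ y _ => f y) = q.sumRuns (fun y h => f y * w h) R.emptyHistory := by
  rw [expect_bob_charlie p q s hw fun y _ => f y]
  congr! 2 with y
  exact funext fun h => Program.sumRuns_noSignal ((hw _).const_mul _) s h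

theorem expect_charlie (hw : ∀ v, NoSignalFrom v w) (f : Bool → ℝ≥0∞) :
    expect w p q s (fun _ _ z => f z) = s.sumRuns (fun z h => f z * w h) R.emptyHistory := by
  rw [expect_bob_charlie p q s hw fun _ z => f z]
  exact Program.sumRuns_noSignal
    (Program.noSignalFrom_sumRuns (by decide) (fun z => (hw _).const_mul _) s) q _

theorem expect_one : expect R.weight p q s (fun _ _ _ => 1) = 1 := by
  rw [expect_bob p q s noSignalFrom_weight fun _ => 1]
  simp only [one_mul]
  rw [Program.sumRuns_weight]
  exact Finset.prod_eq_one fun i _ => (R.res i).empty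

/-- Once Charlie is summed out, all remaining histories are free of his queries, and on these the
cut weight is the original weight. -/
theorem expect_cutWeight_alice_bob (hR : ∀ i, (R.parties i).card ≤ 2)
    (f : Bool → Bool → ℝ≥0∞) :
    expect (cutWeight .bob .charlie) p q s (fun x y _ => f x y)
      = expect R.weight p q s (fun x y _ => f x y) := by
  rw [expect_alice_bob p q s (noSignalFrom_cutWeight hR (by decide)),
    expect_alice_bob p q s noSignalFrom_weight]
  refine Program.sumRuns_congr (P := fun h => forget .charlie h = h)
    (forget_extend_eq (by decide)) (fun x h hh => ?_) p (forget_emptyHistory _)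
  refine Program.sumRuns_congr (P := fun h => forget .charlie h = h)
    (forget_extend_eq (by decide)) (fun y h hh => ?_) q hh
  rw [cutWeight_eq_weight hR (by decide) hh]

theorem expect_cutWeight_alice_charlie (hR : ∀ i, (R.parties i).card ≤ 2)
    (f : Bool → Bool → ℝ≥0∞) :
    expect (cutWeight .bob .charlie) p q s (fun x _ z => f x z)
      = expect R.weight p q s (fun x _ z => f x z) := by
  rw [expect_alice_charlie p q s (noSignalFrom_cutWeight hR (by decide)),
    expect_alice_charlie p q s noSignalFrom_weight]
  refine Program.sumRuns_congr (P := fun h => forget .bob h = h)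
    (forget_extend_eq (by decide)) (fun x h hh => ?_) p (forget_emptyHistory _)
  refine Program.sumRuns_congr (P := fun h => forget .bob h = h)
    (forget_extend_eq (by decide)) (fun y h hh => ?_) s hh
  rw [cutWeight_comm, cutWeight_eq_weight hR (by decide) hh]

/-- Without common resources, the answers of Bob and Charlie are independent. -/
theorem expect_cutWeight_bob_charlie (hR : ∀ i, (R.parties i).card ≤ 2) (f g : Bool → ℝ≥0∞) :
    expect (cutWeight .bob .charlie) p q s (fun _ y z => f y * g z)
      = expect R.weight p q s (fun _ y _ => f y) * expect R.weight p q s (fun _ _ z => g z) := by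
  rw [expect_bob_charlie p q s (noSignalFrom_cutWeight hR (by decide)) fun y z => f y * g z,
    expect_bob p q s noSignalFrom_weight, expect_charlie p q s noSignalFrom_weight]
  -- With Alice summed out, the cut weight is a factor for Bob times a factor for Charlie. Bob's
  -- factor ignores Charlie's queries and so leaves the sum over Charlie's run.
  have hsplit : ∀ y h, forget .alice h = h →
      s.sumRuns (fun z h => f y * g z * cutWeight .bob .charlie h) h
        = s.sumRuns (fun z h => g z * R.weight h) (forget .bob h)
          * (f y * R.weight (forget .charlie h)) := by
    intro y h hh
    rw [mul_comm, ← Program.sumRuns_forget (by decide), ← Program.sumRuns_mul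
      (g := fun h => f y * R.weight (forget .charlie h))]
    · refine Program.sumRuns_congr (P := fun h => forget .alice h = h)
        (forget_extend_eq (by decide)) (fun z h hh => ?_) s hh
      rw [cutWeight_eq_mul (w := .alice) (fun x => by cases x <;> simp) hh]
      ring
    · intro h i hv a x
      simp only
      rw [forget_extend_self h i ⟨.charlie, hv⟩]
  -- Conversely, Charlie's total only sees the history without Bob's queries, so it is constant
  -- along Bob's run.
  rw [Program.sumRuns_congr (P := fun h => forget .alice h = h)
    (forget_extend_eq (by decide)) hsplit q (forget_emptyHistory _), Program.sumRuns_mul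
      (g := fun h => s.sumRuns (fun z h => g z * R.weight h) (forget .bob h)),
    Program.sumRuns_forget (by decide) (fun y h => f y * R.weight h)]
  · simp only [forget_emptyHistory]
    rw [mul_comm]
  · intro h i hv a x
    simp only
    rw [forget_extend_self h i ⟨.bob, hv⟩]

/-- Lists the bits of the three players. -/
def triple {α : Type} (x y z : α) : Player → α
  | .alice => x
  | .bob => y
  | .charlie => z

theorem sum_outcome_filter (π : (v : Player) → R.Program v) (P : (Player → Bool) → Prop)
    [DecidablePred P] :
    ∑ r with P r, R.outcome π r = expect R.weight (π .alice) (π .bob) (π .charlie)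
      (fun x y z => if P (triple x y z) then 1 else 0) := by
  unfold outcome expect
  rw [← Program.sumRuns_sum]
  simp_rw [← Program.sumRuns_sum]
  congr! 6 with x y z
  funext h
  rw [Finset.sum_filter, Finset.sum_eq_single (triple x y z)]
  · simp [triple]
  · intro r _ hr
    have : ¬ (r .alice = x ∧ r .bob = y ∧ r .charlie = z) := by
      rintro ⟨h1, h2, h3⟩
      exact hr (funext fun v => by cases v <;> assumption)
    simp [this]
  · simp

end ResourcePool

/-! ### The bound for deterministic programs -/

namespace ResourcePool

variable {R : ResourcePool}

theorem expect_add_expect_not (p : R.Program .alice) (q : R.Program .bob)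
    (s : R.Program .charlie) (f : Bool → Bool → Bool → Bool) :
    expect R.weight p q s (fun x y z => if f x y z then 1 else 0)
      + expect R.weight p q s (fun x y z => if f x y z then 0 else 1) = 1 := by
  rw [← expect_add]
  refine Eq.trans (congrArg _ ?_) (expect_one p q s)
  funext x y z
  cases f x y z <;> simp

/-- If Alice's answer often agrees with Charlie's and with Bob's, the answers of Bob and Charlie are
close to deterministic, because they agree even if produced independently. -/
theorem expect_mul_expect_not_le (hR : ∀ i, (R.parties i).card ≤ 2) (p : R.Program .alice)
    (q q' : R.Program .bob) (s s' : R.Program .charlie) :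
    expect R.weight p q s (fun _ y _ => if y then 1 else 0)
        * expect R.weight p q s (fun _ _ z => if z then 0 else 1)
      + expect R.weight p q s (fun _ y _ => if y then 0 else 1)
        * expect R.weight p q s (fun _ _ z => if z then 1 else 0)
      ≤ expect R.weight p q s' (fun x y _ => if x = y then 0 else 1)
        + expect R.weight p q' s (fun x _ z => if x = z then 0 else 1) := by
  -- The two errors belong to different questions, but Alice's program is the same in both, so
  -- no-signaling moves them into the single experiment `p`, `q`, `s`.
  have h1 : expect R.weight p q s' (fun x y _ => if x = y then 0 else 1)
      = expect R.weight p q s (fun x y _ => if x = y then 0 else 1) := by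
    rw [expect_alice_bob p q s' noSignalFrom_weight fun x y => if x = y then 0 else 1,
      expect_alice_bob p q s noSignalFrom_weight fun x y => if x = y then 0 else 1]
  have h2 : expect R.weight p q' s (fun x _ z => if x = z then 0 else 1)
      = expect R.weight p q s (fun x _ z => if x = z then 0 else 1) := by
    rw [expect_alice_charlie p q' s noSignalFrom_weight fun x z => if x = z then 0 else 1,
      expect_alice_charlie p q s noSignalFrom_weight fun x z => if x = z then 0 else 1]
  rw [h1, h2, ← expect_cutWeight_bob_charlie p q s hR, ← expect_cutWeight_bob_charlie p q s hR,
    ← expect_cutWeight_alice_bob p q s hR fun x y => if x = y then 0 else 1,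
    ← expect_cutWeight_alice_charlie p q s hR fun x z => if x = z then 0 else 1,
    ← expect_add, ← expect_add]
  -- Pointwise, `y ≠ z` implies `x ≠ y` or `x ≠ z`.
  refine expect_mono p q s fun x y z => ?_
  cases x <;> cases y <;> cases z <;> simp

theorem expect_alice_charlie_eq (p : R.Program .alice) (q q' : R.Program .bob)
    (s : R.Program .charlie) (f : Bool → Bool → ℝ≥0∞) :
    expect R.weight p q s (fun x _ z => f x z) = expect R.weight p q' s (fun x _ z => f x z) := by
  rw [expect_alice_charlie p q s noSignalFrom_weight, expect_alice_charlie p q' s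
    noSignalFrom_weight]

theorem expect_bob_eq (p p' : R.Program .alice) (q : R.Program .bob)
    (s s' : R.Program .charlie) (f : Bool → ℝ≥0∞) :
    expect R.weight p q s (fun _ y _ => f y) = expect R.weight p' q s' (fun _ y _ => f y) := by
  rw [expect_bob p q s noSignalFrom_weight, expect_bob p' q s' noSignalFrom_weight]

/-- A game question with `A = 1`: Bob's answer is compared with `X ⊕ Z`, which does not depend on
his input. -/
theorem expect_xor_le (p p' : R.Program .alice) (q q' : R.Program .bob) (s s' : R.Program .charlie)
    (b : Bool) {f : Bool → Bool → ℝ≥0∞} {g : Bool → ℝ≥0∞}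
    (hfg : ∀ x y z, (if xor (xor x z) y = b then 1 else 0) ≤ f x z + g y) :
    expect R.weight p q s (fun x y z => if xor (xor x z) y = b then 1 else 0)
      ≤ expect R.weight p q' s (fun x _ z => f x z) + expect R.weight p' q s' (fun _ y _ => g y) := by
  rw [expect_alice_charlie_eq p q' q s, expect_bob_eq p' p q s' s, ← expect_add]
  exact expect_mono p q s hfg

/-- Primes denote complementary probabilities. Put `σ = q₀ + q₁`. Adding `h₀` and `h₁` bounds `2 c'
+ e₀' + e₁'` below by `σ (1 - p) + (2 - σ) p`, which is at least `min σ (2 - σ)`, while the bounds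
on `g₀` and `g₁` give `g₀ + g₁ ≤ 1 + min σ (2 - σ)`. The minimum cancels. -/
theorem four_mul_add_le_seven {c c' e₀ e₀' e₁ e₁' g₀ g₁ p p' q₀ q₀' q₁ q₁' w w' : ℝ≥0∞}
    (hc : c + c' = 1) (he₀ : e₀ + e₀' = 1) (he₁ : e₁ + e₁' = 1) (hp : p + p' = 1)
    (hq₀ : q₀ + q₀' = 1) (hq₁ : q₁ + q₁' = 1) (hw : w + w' = 1)
    (h₀ : q₀ * p' + q₀' * p ≤ e₀' + c') (h₁ : q₁ * p' + q₁' * p ≤ e₁' + c')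
    (hg₀ : g₀ ≤ w + q₀') (hg₁ : g₁ ≤ w' + q₁') (hg₀' : g₀ ≤ w' + q₀) (hg₁' : g₁ ≤ w + q₁) :
    4 * c + (e₀ + e₁) + (g₀ + g₁) ≤ 7 := by
  have hfin : ∀ {a b : ℝ≥0∞}, a + b = 1 → a ≠ ⊤ ∧ b ≠ ⊤ := fun {a b} h => by
    rw [← ENNReal.add_ne_top, h]
    exact ENNReal.one_ne_top
  have hg₀f : g₀ ≠ ⊤ := ne_top_of_le_ne_top (ENNReal.add_ne_top.mpr ⟨(hfin hw).1, (hfin hq₀).2⟩) hg₀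
  have hg₁f : g₁ ≠ ⊤ := ne_top_of_le_ne_top (ENNReal.add_ne_top.mpr ⟨(hfin hw).2, (hfin hq₁).2⟩) hg₁
  obtain ⟨fc, fc'⟩ := hfin hc
  obtain ⟨fe₀, fe₀'⟩ := hfin he₀
  obtain ⟨fe₁, fe₁'⟩ := hfin he₁
  obtain ⟨fp, fp'⟩ := hfin hp
  obtain ⟨fq₀, fq₀'⟩ := hfin hq₀
  obtain ⟨fq₁, fq₁'⟩ := hfin hq₁
  obtain ⟨fw, fw'⟩ := hfin hw
  lift c to NNReal using fc
  lift c' to NNReal using fc'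
  lift e₀ to NNReal using fe₀
  lift e₀' to NNReal using fe₀'
  lift e₁ to NNReal using fe₁
  lift e₁' to NNReal using fe₁'
  lift p to NNReal using fp
  lift p' to NNReal using fp'
  lift q₀ to NNReal using fq₀
  lift q₀' to NNReal using fq₀'
  lift q₁ to NNReal using fq₁
  lift q₁' to NNReal using fq₁'
  lift w to NNReal using fw
  lift w' to NNReal using fw'
  lift g₀ to NNReal using hg₀f
  lift g₁ to NNReal using hg₁f
  norm_cast at *
  rw [← NNReal.coe_le_coe] at *
  rw [← NNReal.coe_inj] at hc he₀ he₁ hp hq₀ hq₁ hw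
  push_cast at *
  have hc'0 := c'.coe_nonneg
  have hp0 := p.coe_nonneg
  have hp'0 := p'.coe_nonneg
  have hq0 : (q₀' : ℝ) = 1 - q₀ := by linarith
  have hq1 : (q₁' : ℝ) = 1 - q₁ := by linarith
  have hpp : (p' : ℝ) = 1 - p := by linarith
  rw [hq0, hpp] at h₀
  rw [hq1, hpp] at h₁
  rw [hpp] at hp'0
  -- The case decides which of `σ` and `2 - σ` is the minimum; the product passed to `nlinarith`
  -- shows that the convex combination is not below it.
  rcases le_total ((q₀ : ℝ) + q₁) 1 with hs | hs
  · nlinarith [mul_nonneg hp0 (sub_nonneg.mpr hs)]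
  · nlinarith [mul_nonneg hp'0 (sub_nonneg.mpr hs)]

/-- The winning probability of deterministic programs with two-local resources. -/
theorem expect_win_le (hR : ∀ i, (R.parties i).card ≤ 2) (p₀ p₁ : R.Program .alice)
    (q₀ q₁ q : R.Program .bob) (s₀ s₁ s : R.Program .charlie) :
    4 * expect R.weight p₀ q s₀ (fun x _ z => if x = z then 1 else 0)
      + (expect R.weight p₀ q₀ s (fun x y _ => if x = y then 1 else 0)
        + expect R.weight p₀ q₁ s (fun x y _ => if x = y then 1 else 0))
      + (expect R.weight p₁ q₀ s₁ (fun x y z => if xor (xor x z) y = false then 1 else 0)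
        + expect R.weight p₁ q₁ s₁ (fun x y z => if xor (xor x z) y = true then 1 else 0)) ≤ 7 := by
  -- `p` and `p'` of the arithmetic lemma are the probabilities of `Z = 1` and `Z = 0` for `C = 0`;
  -- they must be the same numbers for both inputs of Bob, which `hz₁` ensures.
  have hz := expect_add_expect_not p₀ q₀ s₀ fun _ _ z => z
  have hz₁ : ∀ f : Bool → ℝ≥0∞, expect R.weight p₀ q₁ s₀ (fun _ _ z => f z)
      = expect R.weight p₀ q₀ s₀ (fun _ _ z => f z) := fun f =>
    expect_alice_charlie_eq p₀ q₁ q₀ s₀ fun _ z => f z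
  have h₁ := expect_mul_expect_not_le hR p₀ q₁ q s₀ s
  rw [hz₁ fun z => if z then 0 else 1, hz₁ fun z => if z then 1 else 0] at h₁
  refine four_mul_add_le_seven ?_ ?_ ?_ hz (expect_add_expect_not p₀ q₀ s₀ fun _ y _ => y)
    (expect_add_expect_not p₀ q₁ s₀ fun _ y _ => y)
    (expect_add_expect_not p₁ q s₁ fun x _ z => xor x z)
    (expect_mul_expect_not_le hR p₀ q₀ q s₀ s) h₁ ?_ ?_ ?_ ?_
  · simpa using expect_add_expect_not p₀ q s₀ fun x _ z => decide (x = z)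
  · simpa using expect_add_expect_not p₀ q₀ s fun x y _ => decide (x = y)
  · simpa using expect_add_expect_not p₀ q₁ s fun x y _ => decide (x = y)
  · exact expect_xor_le p₁ p₀ q₀ q s₁ s₀ false (f := fun x z => if xor x z then 1 else 0)
      (g := fun y => if y then 0 else 1) fun x y z => by
        cases x <;> cases y <;> cases z <;> simp
  · exact expect_xor_le p₁ p₀ q₁ q s₁ s₀ true (f := fun x z => if xor x z then 0 else 1)
      (g := fun y => if y then 0 else 1) fun x y z => by
        cases x <;> cases y <;> cases z <;> simp
  · exact expect_xor_le p₁ p₀ q₀ q s₁ s₀ false (f := fun x z => if xor x z then 0 else 1)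
      (g := fun y => if y then 1 else 0) fun x y z => by
        cases x <;> cases y <;> cases z <;> simp
  · exact expect_xor_le p₁ p₀ q₁ q s₁ s₀ true (f := fun x z => if xor x z then 1 else 0)
      (g := fun y => if y then 1 else 0) fun x y z => by
        cases x <;> cases y <;> cases z <;> simp

end ResourcePool

/-! ### Averaging over the shared randomness -/

namespace ClassicalStrategy

theorem prob_ne_top (S : ClassicalStrategy) (q : Player → Option Bool) (r : Player → Bool) :
    S.prob q r ≠ ⊤ := by
  refine ne_top_of_le_ne_top ENNReal.one_ne_top ?_
  rw [← S.sum_prob q]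
  exact Finset.single_le_sum (f := fun r => S.prob q r) (fun _ _ => zero_le) (Finset.mem_univ r)

theorem sum_filter_correlation (S : ClassicalStrategy) (q : Player → Option Bool)
    (P : (Player → Bool) → Prop) [DecidablePred P] :
    ∑ r with P r, S.correlation.prob q r
      = (∫⁻ l, ∑ r with P r, S.outcome (fun v => S.prog l v (q v)) r ∂S.μ).toReal := by
  rw [MeasureTheory.lintegral_finsetSum _ fun r _ => S.measurable q r]
  exact (ENNReal.toReal_sum (f := S.prob q) fun r _ => S.prob_ne_top q r).symm

theorem winProb_correlation_le (S : ClassicalStrategy) (hS : S.TwoLocal) :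
    ExtendedCHSH.winProb S.correlation ≤ 7 / 8 := by
  classical
  set F : (Player → Option Bool) → ((Player → Bool) → Prop) → S.Λ → ℝ≥0∞ := fun q P l =>
    ∑ r with P r, S.outcome (fun v => S.prog l v (q v)) r with hF
  have hmeas : ∀ q P, Measurable (F q P) := fun q P =>
    Finset.measurable_sum _ fun r _ => S.measurable q r
  have hfin : ∀ q P, ∫⁻ l, F q P l ∂S.μ ≠ ⊤ := fun q P => by
    rw [hF, MeasureTheory.lintegral_finsetSum _ fun r _ => S.measurable q r]
    exact ENNReal.sum_ne_top.mpr fun r _ => S.prob_ne_top q r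
  let c := F ExtendedCHSH.consistencyInput ExtendedCHSH.ConsistencyAccept
  let g := fun a b => F (ExtendedCHSH.gameInput a b) (ExtendedCHSH.GameAccept a b)
  -- The consistency question has weight 1/2 and each game question 1/8; multiplying by 8 gives
  -- these coefficients.
  have key : ∀ l, 4 * c l + (g false false l + g false true l)
      + (g true false l + g true true l) ≤ 7 := by
    intro l
    have := ResourcePool.expect_win_le hS (S.prog l .alice (some false))
      (S.prog l .alice (some true)) (S.prog l .bob (some false)) (S.prog l .bob (some true))
      (S.prog l .bob none) (S.prog l .charlie (some false)) (S.prog l .charlie (some true))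
      (S.prog l .charlie none)
    simp only [c, g, hF, ResourcePool.sum_outcome_filter]
    simp only [ExtendedCHSH.consistencyInput, ExtendedCHSH.gameInput,
      ExtendedCHSH.ConsistencyAccept, ExtendedCHSH.GameAccept, ResourcePool.triple, if_true, Bool.false_eq_true, if_false]
    convert this
    congr
  have hint : 4 * ∫⁻ l, c l ∂S.μ + (∫⁻ l, g false false l ∂S.μ + ∫⁻ l, g false true l ∂S.μ)
      + (∫⁻ l, g true false l ∂S.μ + ∫⁻ l, g true true l ∂S.μ) ≤ 7 := by
    have h := MeasureTheory.lintegral_mono (μ := S.μ) key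
    have hc : Measurable c := hmeas _ _
    have hg : ∀ a b, Measurable (g a b) := fun a b => hmeas _ _
    rw [MeasureTheory.lintegral_add_left (by fun_prop),
      MeasureTheory.lintegral_add_left (by fun_prop), MeasureTheory.lintegral_const_mul _ hc,
      MeasureTheory.lintegral_add_left (hg _ _), MeasureTheory.lintegral_add_left (hg _ _)] at h
    simpa using h
  have hreal := ENNReal.toReal_mono (by simp) hint
  have hcf : ∫⁻ l, c l ∂S.μ ≠ ⊤ := hfin _ _
  have hgf : ∀ a b, ∫⁻ l, g a b l ∂S.μ ≠ ⊤ := fun a b => hfin _ _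
  have hcf' : 4 * ∫⁻ l, c l ∂S.μ ≠ ⊤ := ENNReal.mul_ne_top (by simp) hcf
  rw [ENNReal.toReal_add (by simp [hcf', hgf]) (by simp [hgf]),
    ENNReal.toReal_add hcf' (by simp [hgf]), ENNReal.toReal_add (hgf _ _) (hgf _ _),
    ENNReal.toReal_add (hgf _ _) (hgf _ _), ENNReal.toReal_mul] at hreal
  have h₁ : ExtendedCHSH.consistencyWin S.correlation = (∫⁻ l, c l ∂S.μ).toReal :=
    S.sum_filter_correlation _ _
  have h₂ : ∀ a b, ExtendedCHSH.gameWin S.correlation a b = (∫⁻ l, g a b l ∂S.μ).toReal :=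
    fun a b => S.sum_filter_correlation _ _
  simp only [ENNReal.toReal_ofNat] at hreal
  simp only [ExtendedCHSH.winProb, h₁, h₂, Fintype.sum_bool]
  linarith

end ClassicalStrategy

/-! ### The value of the GHZ strategy -/

theorem sum_player {α M : Type} [Fintype α] [DecidableEq α] [AddCommMonoid M] (f : (Player → α) → M) :
    ∑ r, f r = ∑ x, ∑ y, ∑ z, f (ResourcePool.triple x y z) := by
  let e : (α × α × α) ≃ (Player → α) :=
    { toFun := fun t => ResourcePool.triple t.1 t.2.1 t.2.2
      invFun := fun r => (r .alice, r .bob, r .charlie)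
      left_inv := fun _ => rfl
      right_inv := fun r => funext fun v => by cases v <;> rfl }
  rw [← e.sum_comp, Fintype.sum_prod_type]
  simp_rw [Fintype.sum_prod_type]
  rfl

theorem prod_player {M : Type} [CommMonoid M] (f : Player → M) :
    ∏ v, f v = f .alice * f .bob * f .charlie := by
  have : (Finset.univ : Finset Player) = {.alice, .bob, .charlie} := rfl
  rw [this, Finset.prod_insert (by decide), Finset.prod_insert (by decide),
    Finset.prod_singleton, mul_assoc]

namespace GHZ

theorem state_triple (i j k : Fin 2) :
    state (ResourcePool.triple i j k) = if i = j ∧ j = k then (Real.sqrt 2 : ℂ)⁻¹ else 0 := by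
  have h : ∀ c : Fin 2, ResourcePool.triple i j k = (fun _ => c) ↔ i = c ∧ j = c ∧ k = c := by
    intro c
    constructor
    · intro h
      exact ⟨congrFun h .alice, congrFun h .bob, congrFun h .charlie⟩
    · rintro ⟨rfl, rfl, rfl⟩
      funext v
      cases v <;> rfl
  have h' : ((i = 0 ∧ j = 0 ∧ k = 0) ∨ (i = 1 ∧ j = 1 ∧ k = 1)) ↔ (i = j ∧ j = k) := by
    clear h
    revert i j k
    decide
  unfold state
  simp only [h, h']

/-- Only `|000⟩` and `|111⟩` occur, so all three players share the row index and the column index;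
the factor 1/2 is the square of `1/√2`. -/
theorem amplitude_strategy (q : Player → Option Bool) (r : Player → Bool) :
    strategy.amplitude q r = (1 / 2) * ∑ i, ∑ j,
      effect (observable .alice ((q .alice).getD false)) (r .alice) i j
        * effect (observable .bob ((q .bob).getD false)) (r .bob) i j
        * effect (observable .charlie ((q .charlie).getD false)) (r .charlie) i j := by
  unfold QuantumStrategy.amplitude
  simp only [strategy, sum_player, prod_player, state_triple, Fin.sum_univ_two,
    ResourcePool.triple]
  rw [← sqrt_two_inv_sq]
  simp
  ring

theorem consistencyWin_strategy : ExtendedCHSH.consistencyWin strategy.correlation = 1 := by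
  unfold ExtendedCHSH.consistencyWin
  rw [Finset.sum_filter, sum_player]
  simp only [QuantumStrategy.correlation, amplitude_strategy, ExtendedCHSH.consistencyInput,
    ExtendedCHSH.ConsistencyAccept, ResourcePool.triple, Fintype.sum_bool, Fin.sum_univ_two]
  simp [effect, observable, sign, sigmaX, sigmaZ]
  ring

/-- GHZ is stabilized by `σᶻ ⊗ σᶻ ⊗ 1` and `σˣ ⊗ σˣ ⊗ σˣ` (order Alice, Bob, Charlie). For `a = 0`
only the `σᶻ` part of Bob's observable contributes, for `a = 1` only the `σˣ` part with sign `(-1) ^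
b`. Either way the correlator, signed by the winning condition, is `1/√2`. -/
theorem gameWin_strategy (a b : Bool) :
    ExtendedCHSH.gameWin strategy.correlation a b = (1 + (Real.sqrt 2)⁻¹) / 2 := by
  unfold ExtendedCHSH.gameWin
  rw [Finset.sum_filter, sum_player]
  simp only [QuantumStrategy.correlation, amplitude_strategy, ExtendedCHSH.gameInput,
    ExtendedCHSH.GameAccept, ResourcePool.triple, Fintype.sum_bool, Fin.sum_univ_two]
  cases a <;> cases b <;>
  simp [effect, observable, sign, sigmaX, sigmaZ, ← Complex.ofReal_inv] <;>
  ring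

theorem winProb_strategy :
    ExtendedCHSH.winProb strategy.correlation = 7 / 8 + (Real.sqrt 2 - 1) / 8 := by
  have h : (Real.sqrt 2)⁻¹ = Real.sqrt 2 / 2 := by
    rw [inv_eq_one_div, div_eq_div_iff (by positivity) (by norm_num)]
    norm_num
  simp only [ExtendedCHSH.winProb, consistencyWin_strategy, gameWin_strategy, Fintype.sum_bool, h]
  ring

end GHZ

theorem theoremt :
    (∀ S : ClassicalStrategy, S.TwoLocal → ExtendedCHSH.winProb S.correlation ≤ 7 / 8) ∧
    ExtendedCHSH.winProb GHZ.strategy.correlation = 7 / 8 + (Real.sqrt 2 - 1) / 8 ∧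
    (Real.sqrt 2 - 1) / 8 > 0.0517 := by
  refine ⟨fun S hS => S.winProb_correlation_le hS, GHZ.winProb_strategy, ?_⟩
  -- Three decimals suffice, as `0.414 / 8 = 0.05175`.
  have : (1.414 : ℝ) < Real.sqrt 2 := Real.lt_sqrt_of_sq_lt (by norm_num)
  norm_num at this ⊢
  linarith
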